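/- Corollary 6.5. Let $X$ be a compact Hausdorff space. A subset of $X$ is called perfect if it is non-empty, closed, and has no isolated points in itself; let $\ker(X)$ denote the largest perfect subset of $X$, with $\ker(X)=\emptyset$ if $X$ has no perfect subset. We say that $X$ has the NTIP if every (uniformly) closed complex subalgebra $\mathcal A$ of $C(X,\mathbb C)$ which separates the points of $X$ and contains the constant functions contains a non-trivial idempotent, i.e. a characteristic function $\chi_H$ with $\emptyset \subsetneq H \subsetneq X$. Suppose that $X$ is totally disconnected and that $\ker(X)$ is second countable and non-empty. Then $X$ has the NTIP if and only if $X$ is not second countable. -/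

import Mathlib

/-- `X` has the *non-trivial idempotent property* (for compact `X`): every closed unital complex
subalgebra of `C(X, ℂ)` that separates the points of `X` contains an idempotent `f` other than the
constants `0` and `1`. (For compact `X` the topology on `C(X, ℂ)` is that of the supremum norm;
a `Subalgebra ℂ C(X, ℂ)` always contains the constant functions.) -/
def HasNTIP (X : Type*) [TopologicalSpace X] : Prop :=
  ∀ A : Subalgebra ℂ C(X, ℂ), A.SeparatesPoints → IsClosed (A : Set C(X, ℂ)) →
    ∃ f ∈ A, IsIdempotentElem f ∧ f ≠ 0 ∧ f ≠ 1

/-- The non-trivial idempotents are exactly the continuous characteristic functions of the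
sets `H` with `∅ ≠ H ≠ X`. -/
theorem nontrivial_idempotent_iff {X : Type*} [TopologicalSpace X] (f : C(X, ℂ)) :
    (IsIdempotentElem f ∧ f ≠ 0 ∧ f ≠ 1) ↔
      ∃ H : Set X, H.Nonempty ∧ H ≠ Set.univ ∧ (f : X → ℂ) = H.indicator 1 := by
  classical
  constructor
  · rintro ⟨hf, h0, h1⟩
    have hv : ∀ x, f x = 0 ∨ f x = 1 := fun x =>
      
      IsIdempotentElem.iff_eq_zero_or_one.mp (DFunLike.congr_fun hf x : f x * f x = f x)
    refine ⟨{x | f x = 1}, ?_, ?_, ?_⟩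
    · by_contra h
      apply h0
      ext x
      rcases hv x with hx | hx
      · simpa using hx
      · exact absurd ⟨x, hx⟩ h
    · intro h
      apply h1
      ext x
      have : x ∈ {x | f x = 1} := h ▸ Set.mem_univ x
      simpa using this
    · funext x
      rcases hv x with hx | hx <;> simp [Set.indicator, hx]
  · rintro ⟨H, ⟨a, ha⟩, hne, hf⟩
    obtain ⟨b, hb⟩ := (Set.ne_univ_iff_exists_notMem H).mp hne
    refine ⟨?_, ?_, ?_⟩
    · ext x
      by_cases hx : x ∈ H <;> simp [hf, hx]
    · rintro rfl
      simpa [ha] using congrFun hf a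
    · rintro rfl
      simpa [hb] using congrFun hf b

/-- The kernel `ker(X)` of a space `X` is Mathlib's `CantorBendixson.perfectKernel Set.univ`.
If it is non-empty, it is the largest perfect subset of `X` (non-empty, closed, without
isolated points). -/
theorem kernel_isGreatest {X : Type*} [TopologicalSpace X]
    (h : (CantorBendixson.perfectKernel (Set.univ : Set X)).Nonempty) :
    IsGreatest {P : Set X | P.Nonempty ∧ Perfect P}
      (CantorBendixson.perfectKernel (Set.univ : Set X)) :=
  ⟨⟨h, CantorBendixson.perfect_perfectKernel isClosed_univ⟩,
    fun P hP => hP.2.subset_perfectKernel (Set.subset_univ P)⟩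

/-- The kernel is empty exactly when `X` is scattered, that is, has no perfect subset. -/
theorem kernel_eq_empty_iff {X : Type*} [TopologicalSpace X] :
    CantorBendixson.perfectKernel (Set.univ : Set X) = ∅ ↔
      ∀ P : Set X, Perfect P → ¬ P.Nonempty := by
  constructor
  · intro h P hP hne
    exact (hne.mono (hP.subset_perfectKernel (Set.subset_univ P))).ne_empty h
  · intro h
    exact Set.not_nonempty_iff_eq_empty.mp
      (h _ (CantorBendixson.perfect_perfectKernel isClosed_univ))

/-! Write `K` for the kernel. Let `A` be a closed separating algebra without non-trivial
idempotents. Then every `f ∈ A` attains its norm on `K`. Hence restriction to `K` is isometric on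
`A`, so `A` is separable because `C(K, ℂ)` is; countably many functions then separate the points of
`X`, and `X` is second countable (`secondCountableTopology_of_boundary`).

For the norm claim, suppose `|f x| > max |f|` over `K`. A continuous real function whose range
contains an interval takes values of that interval on `K`
(`exists_mem_perfectKernel_of_Icc_subset_range`). Applied to the distance from a far point in the
direction of `f x`, this yields a circle that misses `f(X)`, with `f x` inside and `f(K)` outside.
The frontier of the spectrum of `f` in `A` lies in `f(X)`, so the circle, which reaches beyond the
disc of radius `‖f‖`, misses that spectrum too, and the spectral idempotent lies in `A`
(`exists_isIdempotentElem_of_sphere`).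

Conversely, a second countable `X` with non-empty kernel embeds in the plane as a compact set `L` of
positive area (`exists_continuous_injective_complex`): a product of two Cantor sets inside `X` is
spread out in both coordinates by adding distribution functions of an atomless measure. Continuous
functions on the Riemann sphere, holomorphic off `L`, have their maximum modulus on `L`, so they
restrict to a closed algebra on `X`; its idempotents are trivial because the sphere is connected. It
separates points thanks to the Cauchy transform `g` of area on `L`, for which `z * g z` tends to
minus the area of `L`, which is not `0`. -/

open Set Filter Topology MeasureTheory OnePoint
open scoped ENNReal

/-! ### Intervals of values and the perfect kernel -/

/-- If the range of a real function on a compact space contains an interval, the function takes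
values of that interval on the perfect kernel. -/
theorem exists_mem_perfectKernel_of_Icc_subset_range {X : Type*} [TopologicalSpace X]
    [CompactSpace X] [T2Space X] {g : X → ℝ} (hg : Continuous g) {a b : ℝ} (hab : a < b)
    (hr : Icc a b ⊆ range g) :
    ∃ x ∈ CantorBendixson.perfectKernel (univ : Set X), g x ∈ Ioo a b := by
  have hle := hab.le
  let π : X → Icc a b := fun x => projIcc a b hle (g x)
  have hπ : Continuous π := continuous_projIcc.comp hg
  have hsurj : Function.Surjective π := by
    rintro ⟨y, hy⟩
    obtain ⟨x, rfl⟩ := hr hy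
    exact ⟨x, projIcc_of_mem hle hy⟩
  -- `E` is minimal among the closed sets that `π` maps onto `[a, b]`; minimality will exclude
  -- isolated points.
  obtain ⟨E, hEc, hE, hmin⟩ := exists_compact_surjective_zorn_subset
    (continuous_uliftUp.comp hπ) (Equiv.ulift.symm.surjective.comp hsurj)
  replace hE : π '' E = univ := by
    refine eq_univ_of_forall fun y => ?_
    obtain ⟨x, hx, hxy⟩ : ULift.up y ∈ (ULift.up ∘ π) '' E := hE ▸ mem_univ _
    exact ⟨x, hx, congrArg ULift.down hxy⟩
  replace hmin : ∀ E₀ : Set E, E₀ ≠ univ → IsClosed E₀ → E.domRestrict π '' E₀ ≠ univ := by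
    refine fun E₀ h1 h2 h3 => hmin E₀ h1 h2 (eq_univ_of_forall fun y => ?_)
    obtain ⟨x, hx, hxy⟩ : y.down ∈ E.domRestrict π '' E₀ := h3 ▸ mem_univ _
    exact ⟨x, hx, congrArg ULift.up hxy⟩
  have hEcl : IsClosed E := (isCompact_iff_compactSpace.mpr hEc).isClosed
  have : ConnectedSpace (Icc a b) := Subtype.connectedSpace (isConnected_Icc hle)
  have : Nontrivial (Icc a b) := ⟨⟨a, left_mem_Icc.mpr hle⟩, ⟨b, right_mem_Icc.mpr hle⟩,
    fun h => hab.ne (congrArg Subtype.val h)⟩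
  have hperf : Perfect E := by
    refine ⟨hEcl, fun x hx => ?_⟩
    by_contra hacc
    have hop : IsOpen ({⟨x, hx⟩} : Set E) := by
      rw [accPt_iff_nhds] at hacc
      push Not at hacc
      obtain ⟨U, hU, hUx⟩ := hacc
      obtain ⟨V, hVU, hV, hxV⟩ := mem_nhds_iff.mp hU
      refine ⟨V, hV, ?_⟩
      ext y
      simp only [mem_preimage, mem_singleton_iff, Subtype.ext_iff]
      exact ⟨fun hy => hUx y ⟨hVU hy, y.2⟩, fun hy => hy ▸ hxV⟩
    -- Without the isolated point, `E` still has a closed image, which contains the dense set of all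
    -- points other than `π x`: it is everything, against minimality.
    have hcl := hop.isClosed_compl
    refine hmin _ (by simp) hcl ?_
    have hcl2 : IsClosed (E.domRestrict π '' {⟨x, hx⟩}ᶜ) :=
      (hcl.isCompact.image (hπ.comp continuous_subtype_val)).isClosed
    have hdense : Dense ({π x}ᶜ : Set (Icc a b)) := by
      have : (𝓝[≠] π x).NeBot := PerfectSpace.not_isolated _
      exact dense_compl_singleton (π x)
    rw [← hcl2.closure_eq]
    refine (hdense.mono ?_).closure_eq
    intro y hy
    obtain ⟨z, hz, rfl⟩ : y ∈ π '' E := hE ▸ mem_univ y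
    refine ⟨⟨z, hz⟩, ?_, rfl⟩
    rintro h
    simp only [mem_singleton_iff, Subtype.mk.injEq] at h
    exact hy (by rw [h]; rfl)
  have hmid : (a + b) / 2 ∈ Ioo a b := ⟨by linarith, by linarith⟩
  obtain ⟨x, hx, hxm⟩ : (⟨_, Ioo_subset_Icc_self hmid⟩ : Icc a b) ∈ π '' E := hE ▸ mem_univ _
  refine ⟨x, hperf.subset_perfectKernel (subset_univ _) hx, ?_⟩
  have h := congrArg Subtype.val hxm
  simp only [π, coe_projIcc] at h
  rcases le_total (g x) b with h1 | h1
  · rcases le_total a (g x) with h2 | h2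
    · rw [min_eq_right h1, max_eq_right h2] at h
      rw [h]; exact hmid
    · rw [min_eq_right h1, max_eq_left h2] at h
      linarith
  · rw [min_eq_left h1, max_eq_right hle] at h
    linarith

/-! ### Spectra in closed subalgebras and idempotents -/

/-- A preconnected set that misses the frontier of `s` but not the complement of `s` misses `s`. -/
theorem IsPreconnected.disjoint_of_disjoint_frontier {α : Type*} [TopologicalSpace α]
    {Γ s : Set α} (hΓ : IsPreconnected Γ) (hs : Disjoint Γ (frontier s)) (hne : (Γ \ s).Nonempty) :
    Disjoint Γ s := by
  rw [disjoint_iff_inter_eq_empty]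
  by_contra h
  obtain ⟨x, hx, hxs⟩ := nonempty_iff_ne_empty.mpr h
  obtain ⟨y, hy, hys⟩ := hne
  have hint : ∀ z ∈ Γ, z ∈ s → z ∈ interior s := fun z hz hzs => by
    by_contra hzi
    exact disjoint_left.mp hs hz ⟨subset_closure hzs, hzi⟩
  have hext : ∀ z ∈ Γ, z ∉ s → z ∈ (closure s)ᶜ := fun z hz hzs hzc =>
    disjoint_left.mp hs hz ⟨hzc, fun hzi => hzs (interior_subset hzi)⟩
  obtain ⟨z, _, hz1, hz2⟩ := hΓ (interior s) (closure s)ᶜ isOpen_interior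
    isClosed_closure.isOpen_compl
    (fun z hz => (em (z ∈ s)).imp (hint z hz) (hext z hz)) ⟨x, hx, hint x hx hxs⟩
    ⟨y, hy, hext y hy hys⟩
  exact hz2 (subset_closure (interior_subset hz1))

/-- Let `f` belong to a closed subalgebra `A` of `C(X, ℂ)`. If a circle misses the range of `f`
and leaves the closed disc of radius `‖f‖`, then it misses the spectrum of `f` in `A`. -/
theorem sphere_disjoint_spectrum {X : Type*} [TopologicalSpace X] [CompactSpace X]
    (A : Subalgebra ℂ C(X, ℂ)) (hA : IsClosed (A : Set C(X, ℂ))) (f : A) {c : ℂ} {ρ : ℝ}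
    (hρ : ∀ x, (f : C(X, ℂ)) x ∉ Metric.sphere c ρ)
    (hout : ∃ z ∈ Metric.sphere c ρ, ‖(f : C(X, ℂ))‖ < ‖z‖) :
    Disjoint (Metric.sphere c ρ) (spectrum ℂ f) := by
  have : CompleteSpace A := hA.completeSpace_coe
  have : IsClosed (A : Set C(X, ℂ)) := hA
  refine (isPreconnected_sphere (by simp [Complex.rank_real_complex]) c ρ
    ).disjoint_of_disjoint_frontier ?_ ?_
  -- Passing to a closed subalgebra adds no frontier points to the spectrum, and in `C(X, ℂ)` the
  -- spectrum is the range.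
  · refine Disjoint.mono_right (Subalgebra.frontier_spectrum A f) ?_
    rw [ContinuousMap.spectrum_eq_range, disjoint_right]
    rintro _ ⟨x, rfl⟩
    exact hρ x
  · obtain ⟨z, hz, hfz⟩ := hout
    refine ⟨z, hz, fun hzs => ?_⟩
    have : Nonempty X := by
      by_contra hX
      rw [not_nonempty_iff] at hX
      have : Subsingleton A := ⟨fun a b => by ext x; exact hX.elim x⟩
      exact (spectrum.of_subsingleton (R := ℂ) f ▸ hzs : z ∈ (∅ : Set ℂ))
    have h1 : ‖z‖ ≤ ‖f‖ * ‖(1 : A)‖ := spectrum.norm_le_norm_mul_of_mem hzs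
    have h2 : ‖(1 : A)‖ = 1 := norm_one (α := C(X, ℂ))
    rw [h2, mul_one] at h1
    exact not_le.mpr hfz h1

/-- A closed unital subalgebra `A` of `C(X, ℂ)` contains a non-trivial idempotent if some `f ∈ A`
takes values inside and outside a circle that misses the range of `f` and leaves the closed disc
of radius `‖f‖`. -/
theorem exists_isIdempotentElem_of_sphere {X : Type*} [TopologicalSpace X] [CompactSpace X]
    (A : Subalgebra ℂ C(X, ℂ)) (hA : IsClosed (A : Set C(X, ℂ))) {f : C(X, ℂ)} (hf : f ∈ A)
    {c : ℂ} {ρ : ℝ} (hρ0 : 0 < ρ) (hρ : ∀ x, f x ∉ Metric.sphere c ρ)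
    (hout : ∃ z ∈ Metric.sphere c ρ, ‖f‖ < ‖z‖) {x₁ x₂ : X} (h₁ : f x₁ ∈ Metric.ball c ρ)
    (h₂ : f x₂ ∉ Metric.ball c ρ) :
    ∃ e ∈ A, IsIdempotentElem e ∧ e ≠ 0 ∧ e ≠ 1 := by
  classical
  have hdisj := sphere_disjoint_spectrum A hA ⟨f, hf⟩ hρ hout
  have hρc : (ρ : ℂ) ≠ 0 := by exact_mod_cast hρ0.ne'
  -- This moves the circle to the unit circle. As the spectrum of `u` misses it, `(1 - u ^ n)⁻¹`
  -- exists in `A`; these inverses tend uniformly to the characteristic function of `H`, replacing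
  -- the contour integral of the Riesz projection.
  let u : A := (ρ : ℂ)⁻¹ • (⟨f, hf⟩ - algebraMap ℂ A c)
  have hu : ∀ x, (u : C(X, ℂ)) x = (ρ : ℂ)⁻¹ * (f x - c) := fun x => by simp [u]
  have hunorm : ∀ x, ‖(u : C(X, ℂ)) x‖ = ρ⁻¹ * dist (f x) c := fun x => by
    rw [hu, norm_mul, norm_inv, Complex.norm_real, Real.norm_of_nonneg hρ0.le, dist_eq_norm]
  have hspec : ∀ z ∈ spectrum ℂ u, ‖z‖ ≠ 1 := by
    intro z hz hz1
    have hmem : c + (ρ : ℂ) * z ∈ Metric.sphere c ρ := by simp [hz1, hρ0.le]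
    refine disjoint_left.mp hdisj hmem ?_
    rw [spectrum.mem_iff] at hz ⊢
    contrapose! hz
    have h : algebraMap ℂ A z - u
        = algebraMap ℂ A (ρ : ℂ)⁻¹ * (algebraMap ℂ A (c + ρ * z) - ⟨f, hf⟩) := by
      simp only [u, Algebra.smul_def, mul_sub, ← map_mul, mul_add, map_add]
      rw [← mul_assoc, inv_mul_cancel₀ hρc, one_mul]
      ring
    rw [h]
    exact ((inv_ne_zero hρc).isUnit.map (algebraMap ℂ A)).mul hz
  have hunit : ∀ n : ℕ, 0 < n → IsUnit (1 - u ^ n) := by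
    intro n hn
    by_contra h
    have h1 : (1 : ℂ) ∈ spectrum ℂ (u ^ n) := by
      rw [spectrum.mem_iff, map_one]; exact h
    rw [spectrum.map_pow_of_pos u hn] at h1
    obtain ⟨z, hz, hz1⟩ := h1
    refine hspec z hz ?_
    have h2 : ‖z‖ ^ n = 1 := by
      rw [← norm_pow]; exact (congrArg norm hz1).trans norm_one
    exact (pow_eq_one_iff_of_nonneg (norm_nonneg z) hn.ne').mp h2
  let H : Set X := f ⁻¹' Metric.ball c ρ
  have hH : IsClopen H := by
    refine ⟨?_, Metric.isOpen_ball.preimage f.continuous⟩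
    have : H = f ⁻¹' Metric.closedBall c ρ := by
      ext x
      have := hρ x
      simp only [H, mem_preimage, Metric.mem_ball, Metric.mem_closedBall, Metric.mem_sphere] at this ⊢
      exact ⟨le_of_lt, fun h => lt_of_le_of_ne h this⟩
    rw [this]
    exact Metric.isClosed_closedBall.preimage f.continuous
  let e : C(X, ℂ) := ⟨H.indicator 1, (continuous_const (y := (1 : ℂ))).indicator
    (by simp [hH.frontier_eq])⟩
  have he : (e : X → ℂ) = H.indicator 1 := rfl
  refine ⟨e, ?_, (nontrivial_idempotent_iff e).mpr ⟨H, ⟨x₁, h₁⟩, fun h => h₂ ?_, he⟩⟩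
  swap
  · exact (h ▸ mem_univ x₂ : x₂ ∈ H)
  -- By compactness `|u| ≤ 1 - δ` on `H` and `|u| ≥ 1 + δ` off `H`, so the convergence is geometric.
  obtain ⟨δ, hδ0, hδ⟩ : ∃ δ > 0, ∀ x, δ ≤ |‖(u : C(X, ℂ)) x‖ - 1| := by
    obtain ⟨y, -, hy⟩ := isCompact_univ.exists_isMinOn ⟨x₁, mem_univ _⟩
      (f := fun x => |‖(u : C(X, ℂ)) x‖ - 1|) (by fun_prop)
    refine ⟨_, ?_, fun x => hy (mem_univ x)⟩
    beta_reduce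
    rw [gt_iff_lt, abs_pos, sub_ne_zero, hunorm]
    intro h
    refine hρ y ?_
    rw [Metric.mem_sphere]
    field_simp at h
    exact h
  have hδ1 : δ ≤ 1 := by
    have h3 := hδ x₁
    have h4 : ‖(u : C(X, ℂ)) x₁‖ < 1 := by
      rw [hunorm, inv_mul_lt_one₀ hρ0]; exact h₁
    rw [abs_of_neg (by linarith)] at h3
    linarith [norm_nonneg ((u : C(X, ℂ)) x₁)]
  have hbound : ∀ n : ℕ, 0 < n → ∀ v : A, v * (1 - u ^ n) = 1 → ∀ x,
      ‖(v : C(X, ℂ)) x - e x‖ ≤ max ((1 - δ) ^ n / (1 - (1 - δ) ^ n)) (((1 + δ) ^ n - 1)⁻¹) := by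
    intro n hn v hv x
    have hvx : (v : C(X, ℂ)) x * (1 - (u : C(X, ℂ)) x ^ n) = 1 :=
      DFunLike.congr_fun (congrArg Subtype.val hv) x
    have hne : 1 - (u : C(X, ℂ)) x ^ n ≠ 0 := right_ne_zero_of_mul_eq_one hvx
    have hnpos : 0 < ‖1 - (u : C(X, ℂ)) x ^ n‖ := norm_pos_iff.mpr hne
    have hvx' : (v : C(X, ℂ)) x = (1 - (u : C(X, ℂ)) x ^ n)⁻¹ := eq_inv_of_mul_eq_one_left hvx
    have hp1 : (1 - δ) ^ n < 1 := pow_lt_one₀ (by linarith) (by linarith) hn.ne'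
    have hp2 : 1 < (1 + δ) ^ n := one_lt_pow₀ (by linarith) hn.ne'
    have h3 := hδ x
    by_cases hx : x ∈ H
    · refine le_trans ?_ (le_max_left _ _)
      have h4 : ‖(u : C(X, ℂ)) x‖ < 1 := by
        rw [hunorm, inv_mul_lt_one₀ hρ0]; exact hx
      rw [abs_of_neg (by linarith)] at h3
      have h5 : ‖(u : C(X, ℂ)) x ^ n‖ ≤ (1 - δ) ^ n := by
        rw [norm_pow]; exact pow_le_pow_left₀ (norm_nonneg _) (by linarith) n
      have h6 : 1 - (1 - δ) ^ n ≤ ‖1 - (u : C(X, ℂ)) x ^ n‖ := by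
        have := norm_sub_norm_le (1 : ℂ) ((u : C(X, ℂ)) x ^ n)
        rw [norm_one] at this
        linarith
      have h7 : (v : C(X, ℂ)) x - e x = (u : C(X, ℂ)) x ^ n / (1 - (u : C(X, ℂ)) x ^ n) := by
        rw [hvx', he, indicator_of_mem hx, Pi.one_apply, eq_div_iff hne, sub_mul,
          inv_mul_cancel₀ hne]
        ring
      rw [h7, norm_div]
      exact div_le_div₀ (pow_nonneg (by linarith) n) h5 (by linarith) h6
    · refine le_trans ?_ (le_max_right _ _)
      have h4 : 1 ≤ ‖(u : C(X, ℂ)) x‖ := by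
        rw [hunorm, ← div_eq_inv_mul, one_le_div hρ0]; exact not_lt.mp hx
      rw [abs_of_nonneg (by linarith)] at h3
      have h5 : (1 + δ) ^ n ≤ ‖(u : C(X, ℂ)) x ^ n‖ := by
        rw [norm_pow]; exact pow_le_pow_left₀ (by linarith) (by linarith) n
      have h6 : (1 + δ) ^ n - 1 ≤ ‖1 - (u : C(X, ℂ)) x ^ n‖ := by
        have := norm_sub_norm_le ((u : C(X, ℂ)) x ^ n) 1
        rw [norm_one, norm_sub_rev] at this
        linarith
      rw [he, indicator_of_notMem hx, sub_zero, hvx', norm_inv]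
      exact inv_anti₀ (by linarith) h6
  have hlim : Tendsto (fun n : ℕ => max ((1 - δ) ^ n / (1 - (1 - δ) ^ n)) (((1 + δ) ^ n - 1)⁻¹))
      atTop (𝓝 0) := by
    have h1 : Tendsto (fun n : ℕ => (1 - δ) ^ n) atTop (𝓝 0) :=
      tendsto_pow_atTop_nhds_zero_of_lt_one (by linarith) (by linarith)
    have h2 : Tendsto (fun n : ℕ => (1 + δ) ^ n - 1) atTop atTop :=
      tendsto_atTop_add_const_right _ _ (tendsto_pow_atTop_atTop_of_one_lt (by linarith))
    have h3 := h1.div (tendsto_const_nhds (x := (1 : ℝ)) |>.sub h1) (by norm_num)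
    rw [zero_div] at h3
    simpa using h3.max h2.inv_tendsto_atTop
  rw [← SetLike.mem_coe, ← hA.closure_eq, Metric.mem_closure_iff]
  intro ε hε
  obtain ⟨n, hn, hn0⟩ := ((hlim.eventually_lt_const hε).and (eventually_gt_atTop 0)).exists
  obtain ⟨v, hv⟩ := (hunit n hn0).exists_left_inv
  refine ⟨v, v.2, ?_⟩
  rw [dist_comm, ContinuousMap.dist_lt_iff hε]
  intro x
  rw [dist_eq_norm]
  exact (hbound n hn0 v hv x).trans_lt hn

/-! ### Norm attained on the kernel, and second countability -/

/-- If a closed separating subalgebra of `C(X, ℂ)` attains all its norms on a second countable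
closed subset, then `X` is second countable. -/
theorem secondCountableTopology_of_boundary {X : Type*} [TopologicalSpace X] [CompactSpace X]
    [T2Space X] (A : Subalgebra ℂ C(X, ℂ)) (hsep : A.SeparatesPoints) {K : Set X}
    (hK : IsClosed K) [SecondCountableTopology K]
    (hb : ∀ f ∈ A, ∀ x, ∃ y ∈ K, ‖f x‖ ≤ ‖f y‖) : SecondCountableTopology X := by
  have : CompactSpace K := isCompact_iff_compactSpace.mp hK.isCompact
  let R : A → C(K, ℂ) := fun f => (f : C(X, ℂ)).restrict K
  have hR : Isometry R := by
    refine Isometry.of_dist_eq fun f g => le_antisymm ?_ ?_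
    · rw [ContinuousMap.dist_le dist_nonneg]
      exact fun x => ContinuousMap.dist_apply_le_dist (f := (f : C(X, ℂ))) (g := g) (x : X)
    · refine (ContinuousMap.dist_le dist_nonneg (f := (f : C(X, ℂ))) (g := g)).mpr fun x => ?_
      obtain ⟨y, hy, hxy⟩ := hb _ (f - g).2 x
      rw [dist_eq_norm]
      refine hxy.trans ?_
      have := ContinuousMap.dist_apply_le_dist (f := R f) (g := R g) ⟨y, hy⟩
      rwa [dist_eq_norm] at this
  have : SecondCountableTopology A := hR.isEmbedding.secondCountableTopology
  obtain ⟨D, hDc, hD⟩ := TopologicalSpace.exists_countable_dense A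
  have : Countable D := hDc
  let Φ : X → (D → ℂ) := fun x d => (d : C(X, ℂ)) x
  have hΦ : Continuous Φ := continuous_pi fun d => (d : C(X, ℂ)).continuous
  have hinj : Function.Injective Φ := by
    intro x y hxy
    by_contra hne
    obtain ⟨_, ⟨f, hf, rfl⟩, hfxy⟩ := hsep hne
    -- Agreeing at `x` and `y` is a closed condition, so it would pass from the dense set `D` to all
    -- of `A`.
    have hcl : IsClosed {g : A | (g : C(X, ℂ)) x = (g : C(X, ℂ)) y} :=
      isClosed_eq ((continuous_eval_const (F := C(X, ℂ)) x).comp continuous_subtype_val)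
        ((continuous_eval_const (F := C(X, ℂ)) y).comp continuous_subtype_val)
    have hall : (⟨f, hf⟩ : A) ∈ {g : A | (g : C(X, ℂ)) x = (g : C(X, ℂ)) y} :=
      closure_minimal (fun d hd => congrFun hxy ⟨d, hd⟩) hcl (hD _)
    exact hfxy hall
  exact (hΦ.isClosedEmbedding hinj).isEmbedding.secondCountableTopology

theorem HasNTIP.of_not_secondCountableTopology {X : Type*} [TopologicalSpace X] [CompactSpace X]
    [T2Space X] (hne : (CantorBendixson.perfectKernel (univ : Set X)).Nonempty)
    [SecondCountableTopology (CantorBendixson.perfectKernel (univ : Set X))]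
    (hX : ¬ SecondCountableTopology X) : HasNTIP X := by
  intro A hsep hA
  have hKc := CantorBendixson.isClosed_perfectKernel (isClosed_univ (X := X))
  by_contra hno
  refine hX (secondCountableTopology_of_boundary A hsep hKc fun f hf x => ?_)
  by_contra hb
  push Not at hb
  obtain ⟨y, hy, hmax⟩ := hKc.isCompact.exists_isMaxOn hne f.continuous.norm.continuousOn
  have hxy := hb y hy
  have hx0 : 0 < ‖f x‖ := (norm_nonneg _).trans_lt hxy
  have hx0' : (‖f x‖ : ℂ) ≠ 0 := by exact_mod_cast hx0.ne'
  have hxf : ‖f x‖ ≤ ‖f‖ := f.norm_coe_le_norm x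
  -- With `s > ‖f‖` every radius `ρ ≥ s - ‖f x‖` is positive, and the far point `(s + ρ) * w` of the
  -- circle has modulus greater than `‖f‖`.
  set s : ℝ := ‖f‖ + 1 with hs
  have hs0 : 0 < s := by positivity
  let w : ℂ := f x / ‖f x‖
  have hw : ‖w‖ = 1 := by simp [w, hx0.ne']
  have hfx : f x = ‖f x‖ * w := by simp only [w]; field_simp
  have hwr : ∀ r : ℝ, ‖(r : ℂ) * w‖ = |r| := fun r => by simp [hw]
  have hgx : dist (f x) (s * w) = s - ‖f x‖ := by
    rw [dist_comm, dist_eq_norm, hfx, ← sub_mul, ← Complex.ofReal_sub, hwr, hwr,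
      abs_of_pos hx0, abs_of_nonneg (by linarith)]
  have hgy : ∀ z, s - ‖f z‖ ≤ dist (f z) (s * w) := fun z => by
    have := norm_sub_norm_le (s * w) (f z)
    rwa [hwr, abs_of_pos hs0, ← dist_eq_norm, dist_comm] at this
  -- On the kernel the distance to `s * w` is at least `s - ‖f y‖`, so it never falls in the open
  -- interval.
  have hnot : ¬ Icc (s - ‖f x‖) (s - ‖f y‖) ⊆ range fun z => dist (f z) (s * w) := by
    intro h
    obtain ⟨z, hz, hz1, hz2⟩ :=
      exists_mem_perfectKernel_of_Icc_subset_range (by fun_prop) (by linarith) h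
    have h1 : ‖f z‖ ≤ ‖f y‖ := hmax hz
    linarith [hgy z]
  obtain ⟨ρ, ⟨hρ1, hρ2⟩, hρ⟩ := not_subset.mp hnot
  refine hno (exists_isIdempotentElem_of_sphere A hA hf (c := s * w) (ρ := ρ) (x₁ := x)
    (x₂ := y) (by linarith) (fun z hz => hρ ⟨z, hz⟩) ⟨(s + ρ : ℝ) * w, ?_, ?_⟩ ?_ ?_)
  · rw [Metric.mem_sphere, dist_eq_norm, ← sub_mul, ← Complex.ofReal_sub, hwr,
      add_sub_cancel_left, abs_of_nonneg (by linarith)]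
  · rw [hwr, abs_of_nonneg (by linarith)]; linarith
  · rw [Metric.mem_ball]
    exact lt_of_le_of_ne (hgx.trans_le hρ1) fun h => hρ ⟨x, h⟩
  · rw [Metric.mem_ball, not_lt]
    exact hρ2.trans (hgy y)

/-! ### Maximum principle on the Riemann sphere -/

/-- Maximum principle for a function on the plane that is holomorphic off `L` and vanishes at
infinity. -/
theorem Complex.norm_le_of_tendsto_cocompact_zero {F : ℂ → ℂ} {L : Set ℂ} (hL : IsClosed L)
    (hF : Continuous F) (hd : DifferentiableOn ℂ F Lᶜ) (hlim : Tendsto F (cocompact ℂ) (𝓝 0))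
    {M : ℝ} (hM0 : 0 ≤ M) (hM : ∀ z ∈ L, ‖F z‖ ≤ M) (z : ℂ) : ‖F z‖ ≤ M := by
  refine le_of_forall_pos_le_add fun ε hε => ?_
  have hev : ∀ᶠ w in cocompact ℂ, ‖F w‖ < ε :=
    (tendsto_zero_iff_norm_tendsto_zero.mp hlim).eventually_lt_const hε
  rw [← Metric.cobounded_eq_cocompact, (Metric.hasBasis_cobounded_compl_ball 0).eventually_iff] at hev
  obtain ⟨R, -, hR⟩ := hev
  by_cases hz : z ∈ Metric.ball (0 : ℂ) R
  · by_cases hzL : z ∈ L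
    · linarith [hM z hzL]
    have hU : IsOpen (Metric.ball (0 : ℂ) R ∩ Lᶜ) := Metric.isOpen_ball.inter hL.isOpen_compl
    refine Complex.norm_le_of_forall_mem_frontier_norm_le
      (Metric.isBounded_ball.subset inter_subset_left)
      ⟨hd.mono inter_subset_right, hF.continuousOn⟩ (fun w hw => ?_)
      (subset_closure (⟨hz, hzL⟩ : z ∈ Metric.ball (0 : ℂ) R ∩ Lᶜ))
    rw [hU.frontier_eq] at hw
    by_cases hwL : w ∈ L
    · linarith [hM w hwL]
    · have := hR (fun hwR => hw.2 ⟨hwR, hwL⟩)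
      linarith
  · linarith [hR hz]

/-- Maximum principle for a function on the Riemann sphere that is holomorphic off a non-empty
closed set `L` of finite points. -/
theorem Complex.norm_le_of_tendsto_cocompact {F : ℂ → ℂ} {L : Set ℂ} (hL : IsClosed L)
    (hLne : L.Nonempty) (hF : Continuous F) (hd : DifferentiableOn ℂ F Lᶜ) {c : ℂ}
    (hlim : Tendsto F (cocompact ℂ) (𝓝 c)) {B : ℝ} (hB : ∀ z, ‖F z - c‖ ≤ B)
    {M : ℝ} (hM : ∀ z ∈ L, ‖F z‖ ≤ M) (z : ℂ) : ‖F z‖ ≤ M := by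
  obtain ⟨l, hl⟩ := hLne
  have hM0 : 0 ≤ M := (norm_nonneg _).trans (hM l hl)
  have hB0 : 0 ≤ B := (norm_nonneg _).trans (hB l)
  have hkey : ∀ w, M < ‖F w‖ → F w = c := by
    intro w hw
    by_contra hne
    have hw0 : 0 < ‖F w‖ := hM0.trans_lt hw
    -- The factor `F - c` forces vanishing at infinity; the power `F ^ n` makes its cost negligible
    -- as `n` grows.
    have hpow : ∀ n : ℕ, ‖F w - c‖ ≤ (M / ‖F w‖) ^ n * B := by
      intro n
      have h := Complex.norm_le_of_tendsto_cocompact_zero (F := fun v => F v ^ n * (F v - c)) hL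
        (by fun_prop) ((hd.pow n).mul (hd.sub_const c))
        (by simpa using (hlim.pow n).mul (hlim.sub_const c)) (M := M ^ n * B) (by positivity)
        (fun v hv => by
          rw [norm_mul, norm_pow]
          exact mul_le_mul (pow_le_pow_left₀ (norm_nonneg _) (hM v hv) n) (hB v) (norm_nonneg _)
            (by positivity)) w
      rw [norm_mul, norm_pow] at h
      rw [div_pow, div_mul_eq_mul_div, le_div_iff₀ (by positivity), mul_comm]
      exact h
    have hlim0 : Tendsto (fun n : ℕ => (M / ‖F w‖) ^ n * B) atTop (𝓝 0) := by
      simpa using (tendsto_pow_atTop_nhds_zero_of_lt_one (by positivity)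
        ((div_lt_one hw0).mpr hw)).mul_const B
    have := ge_of_tendsto' hlim0 hpow
    exact hne (sub_eq_zero.mp (norm_le_zero_iff.mp this))
  by_contra hz
  rw [not_le] at hz
  have hcM : M < ‖c‖ := hkey z hz ▸ hz
  -- One description is closed and the other open, so by connectedness the set is the whole plane;
  -- yet it omits `l`.
  have hset : F ⁻¹' {c} = {w | M < ‖F w‖} := by
    ext w
    exact ⟨fun h => by rw [mem_preimage, mem_singleton_iff] at h; simpa [h] using hcM, hkey w⟩
  have hclopen : IsClopen (F ⁻¹' {c}) :=
    ⟨isClosed_singleton.preimage hF, hset ▸ isOpen_lt continuous_const hF.norm⟩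
  have huniv := hclopen.eq_univ ⟨z, hkey z hz⟩
  have hlc : l ∈ {w | M < ‖F w‖} := hset ▸ huniv ▸ mem_univ l
  exact not_lt.mpr (hM l hl) hlc

/-! ### The algebra of functions holomorphic off a plane set -/

/-- The continuous functions on the Riemann sphere that are holomorphic on the plane off `L`. -/
def holomorphicOffSubalgebra (L : Set ℂ) : Subalgebra ℂ C(OnePoint ℂ, ℂ) where
  carrier := {F | DifferentiableOn ℂ (fun z : ℂ => F z) Lᶜ}
  mul_mem' hF hG := hF.mul hG
  add_mem' hF hG := hF.add hG
  algebraMap_mem' c := differentiableOn_const c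

theorem isClosed_holomorphicOffSubalgebra {L : Set ℂ} (hL : IsClosed L) :
    IsClosed (holomorphicOffSubalgebra L : Set C(OnePoint ℂ, ℂ)) := by
  refine isClosed_of_closure_subset fun F hF => ?_
  obtain ⟨u, hu, hlim⟩ := mem_closure_iff_seq_limit.mp hF
  have hunif := ContinuousMap.tendsto_iff_tendstoUniformly.mp hlim
  have h2 : TendstoUniformly (fun n (z : ℂ) => u n z) (fun z : ℂ => F z) atTop :=
    hunif.comp (fun z : ℂ => (z : OnePoint ℂ))
  exact h2.tendstoUniformlyOn.tendstoLocallyUniformlyOn.differentiableOn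
    (Eventually.of_forall hu) hL.isOpen_compl

theorem tendsto_cocompact_infty (F : C(OnePoint ℂ, ℂ)) :
    Tendsto (fun z : ℂ => F z) (cocompact ℂ) (𝓝 (F ∞)) := by
  have := ((OnePoint.continuous_iff F).mp F.continuous).1
  rwa [coclosedCompact_eq_cocompact] at this

theorem norm_le_of_mem_holomorphicOffSubalgebra {L : Set ℂ} (hL : IsClosed L) (hLne : L.Nonempty)
    {F : C(OnePoint ℂ, ℂ)} (hF : F ∈ holomorphicOffSubalgebra L) {M : ℝ}
    (hM : ∀ z ∈ L, ‖F (z : ℂ)‖ ≤ M) : ‖F‖ ≤ M := by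
  have hfin : ∀ z : ℂ, ‖F z‖ ≤ M :=
    Complex.norm_le_of_tendsto_cocompact hL hLne
      (F.continuous.comp OnePoint.continuous_coe) hF (tendsto_cocompact_infty F)
      (B := ‖F‖ + ‖F‖) (fun z => (norm_sub_le _ _).trans
        (add_le_add (F.norm_coe_le_norm _) (F.norm_coe_le_norm _))) hM
  obtain ⟨l, hl⟩ := hLne
  rw [ContinuousMap.norm_le _ ((norm_nonneg _).trans (hM l hl))]
  intro x
  induction x using OnePoint.rec with
  | infty => exact le_of_tendsto' (tendsto_cocompact_infty F).norm hfin
  | coe z => exact hfin z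

/-- Restriction along `φ : X → ℂ` of functions on the Riemann sphere. -/
noncomputable def sphereRestrict {X : Type*} [TopologicalSpace X] (φ : C(X, ℂ)) :
    C(OnePoint ℂ, ℂ) →ₐ[ℂ] C(X, ℂ) :=
  ContinuousMap.compRightAlgHom ℂ ℂ ((⟨_, OnePoint.continuous_coe⟩ : C(ℂ, OnePoint ℂ)).comp φ)

/-- By the maximum principle the restriction is isometric, and an isometric image of a complete
algebra is closed. -/
theorem isClosed_map_sphereRestrict {X : Type*} [TopologicalSpace X] [CompactSpace X]
    (φ : C(X, ℂ)) {L : Set ℂ} (hL : IsClosed L) (hLne : L.Nonempty) (hLφ : L ⊆ range φ) :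
    IsClosed ((holomorphicOffSubalgebra L).map (sphereRestrict φ) : Set C(X, ℂ)) := by
  have : CompleteSpace (holomorphicOffSubalgebra L) :=
    (isClosed_holomorphicOffSubalgebra hL).completeSpace_coe
  let ρ : holomorphicOffSubalgebra L → C(X, ℂ) := fun F => sphereRestrict φ F
  have hρ : Isometry ρ := by
    refine Isometry.of_dist_eq fun F G => le_antisymm ?_ ?_
    · rw [ContinuousMap.dist_le dist_nonneg]
      exact fun x => ContinuousMap.dist_apply_le_dist (f := (F : C(OnePoint ℂ, ℂ))) (g := G) _
    · rw [Subtype.dist_eq, dist_eq_norm]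
      refine norm_le_of_mem_holomorphicOffSubalgebra hL hLne (F - G).2 fun z hz => ?_
      obtain ⟨x, rfl⟩ := hLφ hz
      have := ContinuousMap.dist_apply_le_dist (f := ρ F) (g := ρ G) x
      rwa [dist_eq_norm] at this
  have hrange : ((holomorphicOffSubalgebra L).map (sphereRestrict φ) : Set C(X, ℂ)) = range ρ := by
    ext f
    simp [ρ]
  rw [hrange]
  exact hρ.isClosedEmbedding.isClosed_range

/-- The equation `F * F = F` holds on `L`, hence on the whole sphere by the maximum principle, and
the sphere is connected. -/
theorem eq_zero_or_eq_one_of_mem_map_sphereRestrict {X : Type*} [TopologicalSpace X]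
    (φ : C(X, ℂ)) {L : Set ℂ} (hL : IsClosed L) (hLne : L.Nonempty) (hLφ : L ⊆ range φ)
    {f : C(X, ℂ)} (hf : f ∈ (holomorphicOffSubalgebra L).map (sphereRestrict φ))
    (hidem : IsIdempotentElem f) : f = 0 ∨ f = 1 := by
  obtain ⟨F, hF, rfl⟩ := hf
  have hF2 : ‖F * F - F‖ ≤ 0 := by
    refine norm_le_of_mem_holomorphicOffSubalgebra hL hLne
      (Subalgebra.sub_mem _ (Subalgebra.mul_mem _ hF hF) hF) fun z hz => ?_
    obtain ⟨x, rfl⟩ := hLφ hz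
    have := DFunLike.congr_fun hidem x
    rw [norm_le_zero_iff]
    exact sub_eq_zero.mpr this
  rw [norm_le_zero_iff, sub_eq_zero] at hF2
  have hv : ∀ y, F y = 0 ∨ F y = 1 := fun y =>
    IsIdempotentElem.iff_eq_zero_or_one.mp (DFunLike.congr_fun hF2 y : F y * F y = F y)
  have hclopen : IsClopen (F ⁻¹' {0}) := by
    refine ⟨isClosed_singleton.preimage F.continuous, ?_⟩
    have : F ⁻¹' {0} = F ⁻¹' {1}ᶜ := by
      ext y
      rcases hv y with h | h <;> simp [h]
    rw [this]
    exact isOpen_compl_singleton.preimage F.continuous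
  rcases isClopen_iff.mp hclopen with h | h
  · right
    ext x
    exact (hv (φ x)).resolve_left fun h0 =>
      (h ▸ (show (φ x : OnePoint ℂ) ∈ F ⁻¹' {0} from h0) : _ ∈ (∅ : Set (OnePoint ℂ)))
  · left
    ext x
    exact (h ▸ mem_univ _ : (φ x : OnePoint ℂ) ∈ F ⁻¹' {0})

/-- A continuous function on the sphere, holomorphic off `L`, with a simple zero at infinity yields
functions separating any two finite points. -/
theorem exists_mem_holomorphicOffSubalgebra_ne {L : Set ℂ} (hL : IsCompact L) {g : ℂ → ℂ}
    (hg : Continuous g) (hd : DifferentiableOn ℂ g Lᶜ) {m : ℂ} (hm : m ≠ 0)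
    (hlim : Tendsto (fun z => z * g z) (cocompact ℂ) (𝓝 m)) {a b : ℂ} (hab : a ≠ b) :
    ∃ F ∈ holomorphicOffSubalgebra L, F (a : OnePoint ℂ) ≠ F (b : OnePoint ℂ) := by
  have hinv : Tendsto (fun z : ℂ => z⁻¹) (cocompact ℂ) (𝓝 0) := by
    rw [← Metric.cobounded_eq_cocompact]; exact tendsto_inv₀_cobounded
  have hne0 : ∀ᶠ z in cocompact ℂ, z ≠ (0 : ℂ) := by
    exact (isCompact_singleton (x := (0 : ℂ))).compl_mem_cocompact
  have hg0 : Tendsto g (cocompact ℂ) (𝓝 0) := by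
    have := hinv.mul hlim
    rw [zero_mul] at this
    refine this.congr' ?_
    filter_upwards [hne0] with z hz
    field_simp
  have hmk : ∀ h : ℂ → ℂ, Continuous h → DifferentiableOn ℂ h Lᶜ →
      Tendsto h (cocompact ℂ) (𝓝 0) → h a ≠ h b →
      ∃ F ∈ holomorphicOffSubalgebra L, F (a : OnePoint ℂ) ≠ F (b : OnePoint ℂ) := by
    intro h hc hdh hl hne
    exact ⟨OnePoint.continuousMapMk ⟨h, hc⟩ 0 (by rwa [coclosedCompact_eq_cocompact]), hdh, hne⟩
  by_contra hcon
  have hgab : g a = g b := by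
    by_contra hne
    exact hcon (hmk g hg hd hg0 hne)
  -- Dividing `g - g p` by `z - p` creates a new member of the algebra. Its values at `a` and `b`
  -- have the same numerator but different denominators, so they differ unless `g p = g a`.
  have hconst : ∀ p ∉ L, p ≠ a → p ≠ b → g p = g a := by
    intro p hp hpa hpb
    by_contra hne
    have hpn : Lᶜ ∈ 𝓝 p := hL.isClosed.isOpen_compl.mem_nhds hp
    have hgp : DifferentiableAt ℂ g p := hd.differentiableAt hpn
    refine hcon (hmk (dslope g p) ?_ ((Complex.differentiableOn_dslope hpn).mpr hd) ?_ ?_)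
    · rw [← continuousOn_univ, continuousOn_dslope univ_mem]
      exact ⟨hg.continuousOn, hgp⟩
    · have h1 : Tendsto (fun z => (z - p)⁻¹ * (g z - g p)) (cocompact ℂ) (𝓝 0) := by
        have h2 : Tendsto (fun z : ℂ => (z - p)⁻¹) (cocompact ℂ) (𝓝 0) :=
          hinv.comp (Homeomorph.subRight p).isClosedEmbedding.tendsto_cocompact
        simpa using h2.mul (hg0.sub_const (g p))
      refine h1.congr' ?_
      have : ∀ᶠ z in cocompact ℂ, z ≠ p := (isCompact_singleton (x := p)).compl_mem_cocompact
      filter_upwards [this] with z hz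
      rw [dslope_of_ne _ hz, slope_def_field]
      ring
    · rw [dslope_of_ne _ hpa.symm, dslope_of_ne _ hpb.symm, slope_def_field, slope_def_field,
        ← hgab, Ne, div_eq_div_iff (sub_ne_zero.mpr hpa.symm) (sub_ne_zero.mpr hpb.symm)]
      intro h
      have h3 : (g a - g p) * (b - a) = 0 := by linear_combination h
      rcases mul_eq_zero.mp h3 with h4 | h4
      · exact hne (sub_eq_zero.mp h4).symm
      · exact hab (sub_eq_zero.mp h4).symm
  have hev : ∀ᶠ p in cocompact ℂ, g p = g a := by
    have h1 : ∀ᶠ z in cocompact ℂ, z ≠ a := (isCompact_singleton (x := a)).compl_mem_cocompact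
    have h2 : ∀ᶠ z in cocompact ℂ, z ≠ b := (isCompact_singleton (x := b)).compl_mem_cocompact
    filter_upwards [hL.compl_mem_cocompact, h1, h2] with p hp hpa hpb using hconst p hp hpa hpb
  have hga : g a = 0 :=
    tendsto_nhds_unique (tendsto_const_nhds.congr' (hev.mono fun p hp => hp.symm)) hg0
  refine hm (tendsto_nhds_unique hlim (tendsto_const_nhds.congr' ?_))
  filter_upwards [hev] with p hp
  rw [hp, hga, mul_zero]

/-! ### The Cauchy transform of area -/

/-- The Cauchy kernel `z⁻¹`, truncated near the origin so as to be continuous. -/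
noncomputable def truncatedInv (ε : ℝ) (z : ℂ) : ℂ :=
  (starRingEnd ℂ) z * (((max (‖z‖ ^ 2) (ε ^ 2))⁻¹ : ℝ) : ℂ)

theorem continuous_truncatedInv {ε : ℝ} (hε : 0 < ε) : Continuous (truncatedInv ε) := by
  have h : ∀ z : ℂ, max (‖z‖ ^ 2) (ε ^ 2) ≠ 0 := fun z => by positivity
  unfold truncatedInv
  refine Complex.continuous_conj.mul (Complex.continuous_ofReal.comp (Continuous.inv₀ ?_ h))
  fun_prop

theorem norm_truncatedInv_le {ε : ℝ} (hε : 0 < ε) (z : ℂ) : ‖truncatedInv ε z‖ ≤ ε⁻¹ := by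
  have h0 : 0 < max (‖z‖ ^ 2) (ε ^ 2) := by positivity
  rw [truncatedInv, norm_mul, RCLike.norm_conj, Complex.norm_real, norm_inv,
    Real.norm_of_nonneg h0.le, ← div_eq_mul_inv, div_le_iff₀ h0, ← div_eq_inv_mul,
    le_div_iff₀ hε]
  rcases le_total ‖z‖ ε with h | h
  · exact le_trans (by nlinarith) (le_max_right _ _)
  · exact le_trans (by nlinarith) (le_max_left _ _)

theorem inv_sub_truncatedInv_eq_zero {ε : ℝ} (hε : 0 < ε) {z : ℂ} (hz : ε ≤ ‖z‖) :
    z⁻¹ - truncatedInv ε z = 0 := by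
  rw [truncatedInv, max_eq_left (pow_le_pow_left₀ hε.le hz 2), Complex.inv_def,
    Complex.normSq_eq_norm_sq, sub_self]

theorem norm_inv_sub_truncatedInv_le {ε : ℝ} {z : ℂ} (hz : ‖z‖ < ε) :
    ‖z⁻¹ - truncatedInv ε z‖ ≤ ‖z‖⁻¹ := by
  rcases eq_or_ne z 0 with rfl | h0
  · simp [truncatedInv]
  have hz0 : 0 < ‖z‖ := norm_pos_iff.mpr h0
  have hsq : ‖z‖ ^ 2 ≤ ε ^ 2 := pow_le_pow_left₀ hz0.le hz.le 2
  have hinv : (ε ^ 2)⁻¹ ≤ (‖z‖ ^ 2)⁻¹ := inv_anti₀ (by positivity) hsq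
  have hε : 0 ≤ (ε ^ 2)⁻¹ := by positivity
  rw [truncatedInv, max_eq_right hsq, Complex.inv_def, Complex.normSq_eq_norm_sq, ← mul_sub,
    ← Complex.ofReal_sub, norm_mul, RCLike.norm_conj, Complex.norm_real,
    Real.norm_of_nonneg (by linarith)]
  calc ‖z‖ * ((‖z‖ ^ 2)⁻¹ - (ε ^ 2)⁻¹) ≤ ‖z‖ * (‖z‖ ^ 2)⁻¹ := by
        apply mul_le_mul_of_nonneg_left _ hz0.le; linarith
    _ = ‖z‖⁻¹ := by field_simp

/-- In polar coordinates the Jacobian `r` cancels the bound `1 / r`: the integrand is at most `1` on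
a rectangle of area `2πε` and zero elsewhere. -/
theorem lintegral_enorm_inv_sub_truncatedInv_le {ε : ℝ} (hε : 0 < ε) :
    ∫⁻ z : ℂ, ‖z⁻¹ - truncatedInv ε z‖ₑ ≤ ENNReal.ofReal (2 * Real.pi * ε) := by
  rw [← Complex.lintegral_comp_polarCoord_symm]
  have hle : ∀ p ∈ polarCoord.target,
      ENNReal.ofReal p.1 • ‖(Complex.polarCoord.symm p)⁻¹ -
        truncatedInv ε (Complex.polarCoord.symm p)‖ₑ
      ≤ (Ioo 0 ε ×ˢ Ioo (-Real.pi) Real.pi).indicator (1 : ℝ × ℝ → ℝ≥0∞) p := by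
    rintro p ⟨hp1, hp2⟩
    have hp1 : 0 < p.1 := hp1
    have hn : ‖Complex.polarCoord.symm p‖ = p.1 := by
      rw [Complex.norm_polarCoord_symm, abs_of_pos hp1]
    rcases lt_or_ge p.1 ε with h | h
    · rw [indicator_of_mem (show p ∈ Ioo 0 ε ×ˢ Ioo (-Real.pi) Real.pi from ⟨⟨hp1, h⟩, hp2⟩),
        Pi.one_apply, smul_eq_mul, ← ofReal_norm, ← ENNReal.ofReal_mul hp1.le,
        ENNReal.ofReal_le_one]
      calc _ ≤ p.1 * p.1⁻¹ := by
            refine mul_le_mul_of_nonneg_left ?_ hp1.le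
            have := norm_inv_sub_truncatedInv_le (ε := ε) (z := Complex.polarCoord.symm p)
              (by rwa [hn])
            rwa [hn] at this
        _ = 1 := mul_inv_cancel₀ hp1.ne'
    · rw [inv_sub_truncatedInv_eq_zero hε (by rwa [hn])]
      simp
  refine (setLIntegral_mono' polarCoord.open_target.measurableSet hle).trans ?_
  refine (setLIntegral_le_lintegral _ _).trans ?_
  rw [lintegral_indicator_one (measurableSet_Ioo.prod measurableSet_Ioo),
    Measure.volume_eq_prod, Measure.prod_prod, Real.volume_Ioo, Real.volume_Ioo,
    ← ENNReal.ofReal_mul (by linarith)]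
  apply le_of_eq
  congr 1
  ring

/-- The Cauchy transform of the area measure on `L`. -/
noncomputable def cauchyTransform (L : Set ℂ) (w : ℂ) : ℂ := ∫ ζ in L, (ζ - w)⁻¹

theorem lintegral_enorm_cauchyKernel_sub_le (L : Set ℂ) {ε : ℝ} (hε : 0 < ε) (w : ℂ) :
    ∫⁻ ζ in L, ‖(ζ - w)⁻¹ - truncatedInv ε (ζ - w)‖ₑ ≤ ENNReal.ofReal (2 * Real.pi * ε) := by
  refine (setLIntegral_le_lintegral _ _).trans ?_
  rw [lintegral_sub_right_eq_self (fun z : ℂ => ‖z⁻¹ - truncatedInv ε z‖ₑ) w]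
  exact lintegral_enorm_inv_sub_truncatedInv_le hε

theorem integrable_truncatedInv_sub {L : Set ℂ} (hL : IsCompact L) {ε : ℝ} (hε : 0 < ε) (w : ℂ) :
    IntegrableOn (fun ζ => truncatedInv ε (ζ - w)) L :=
  ((continuous_truncatedInv hε).comp (continuous_id.sub continuous_const)
    ).continuousOn.integrableOn_compact hL

theorem measurable_cauchyKernel_sub {ε : ℝ} (hε : 0 < ε) (w : ℂ) :
    Measurable fun ζ : ℂ => (ζ - w)⁻¹ - truncatedInv ε (ζ - w) :=
  (measurable_id.sub_const w).inv.sub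
    ((continuous_truncatedInv hε).measurable.comp (measurable_id.sub_const w))

theorem integrableOn_cauchyKernel_sub (L : Set ℂ) {ε : ℝ} (hε : 0 < ε) (w : ℂ) :
    IntegrableOn (fun ζ => (ζ - w)⁻¹ - truncatedInv ε (ζ - w)) L :=
  ⟨(measurable_cauchyKernel_sub hε w).aestronglyMeasurable,
    (lintegral_enorm_cauchyKernel_sub_le L hε w).trans_lt ENNReal.ofReal_lt_top⟩

theorem integrableOn_cauchyKernel {L : Set ℂ} (hL : IsCompact L) (w : ℂ) :
    IntegrableOn (fun ζ => (ζ - w)⁻¹) L := by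
  exact Integrable.congr ((integrableOn_cauchyKernel_sub L one_pos w).add
    (integrable_truncatedInv_sub hL one_pos w)) (Eventually.of_forall fun ζ => sub_add_cancel _ _)

/-- The transforms with truncated kernel are continuous and converge uniformly, since the error
`2πε` does not depend on `w`. -/
theorem continuous_cauchyTransform {L : Set ℂ} (hL : IsCompact L) :
    Continuous (cauchyTransform L) := by
  have : IsFiniteMeasure (volume.restrict L) := ⟨by simpa using hL.measure_lt_top⟩
  refine continuous_of_uniform_approx_of_continuous fun u hu => ?_
  obtain ⟨δ, hδ, hu⟩ := Metric.mem_uniformity_dist.mp hu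
  have hε : 0 < δ / (4 * Real.pi) := by positivity
  set ε := δ / (4 * Real.pi) with hεdef
  refine ⟨fun w => ∫ ζ in L, truncatedInv ε (ζ - w), ?_, fun w => hu ?_⟩
  · refine continuous_of_dominated (bound := fun _ => ε⁻¹)
      (fun w => (integrable_truncatedInv_sub hL hε w).aestronglyMeasurable)
      (fun w => Eventually.of_forall fun ζ => norm_truncatedInv_le hε _)
      (integrable_const _) (Eventually.of_forall fun ζ => ?_)
    exact (continuous_truncatedInv hε).comp (by fun_prop)
  · rw [dist_eq_norm, cauchyTransform, ← integral_sub (integrableOn_cauchyKernel hL w)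
      (integrable_truncatedInv_sub hL hε w)]
    have h1 := enorm_integral_le_lintegral_enorm (μ := volume.restrict L)
      fun ζ => (ζ - w)⁻¹ - truncatedInv ε (ζ - w)
    have h2 := h1.trans (lintegral_enorm_cauchyKernel_sub_le L hε w)
    rw [← ofReal_norm, ENNReal.ofReal_le_ofReal_iff (by positivity)] at h2
    refine h2.trans_lt ?_
    rw [hεdef]
    field_simp
    linarith

theorem differentiableOn_cauchyTransform {L : Set ℂ} (hL : IsCompact L) :
    DifferentiableOn ℂ (cauchyTransform L) Lᶜ := by
  have : IsFiniteMeasure (volume.restrict L) := ⟨by simpa using hL.measure_lt_top⟩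
  intro w hw
  obtain ⟨d, hd, hball⟩ := Metric.isOpen_iff.mp hL.isClosed.isOpen_compl w hw
  have hfar : ∀ ζ ∈ L, ∀ z ∈ Metric.ball w (d / 2), d / 2 ≤ ‖ζ - z‖ := by
    intro ζ hζ z hz
    have h1 : d ≤ dist ζ w := by
      by_contra h
      exact hball (not_le.mp h) hζ
    have h2 := dist_triangle ζ z w
    rw [Metric.mem_ball] at hz
    rw [← dist_eq_norm]
    linarith
  have hd2 : 0 < d / 2 := by linarith
  refine (hasDerivAt_integral_of_dominated_loc_of_deriv_le (μ := volume.restrict L)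
    (F := fun z ζ => (ζ - z)⁻¹) (F' := fun z ζ => ((ζ - z) ^ 2)⁻¹)
    (bound := fun _ => ((d / 2) ^ 2)⁻¹) (Metric.ball_mem_nhds w hd2)
    (Eventually.of_forall fun z => (integrableOn_cauchyKernel hL z).aestronglyMeasurable)
    (integrableOn_cauchyKernel hL w) ?_ ?_ (integrable_const _) ?_
    ).2.differentiableAt.differentiableWithinAt
  · exact ((measurable_id.sub_const w).pow_const 2).inv.aestronglyMeasurable
  · refine (ae_restrict_iff' hL.measurableSet).mpr (Eventually.of_forall fun ζ hζ z hz => ?_)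
    rw [norm_inv, norm_pow]
    exact inv_anti₀ (by positivity) (pow_le_pow_left₀ hd2.le (hfar ζ hζ z hz) 2)
  · refine (ae_restrict_iff' hL.measurableSet).mpr (Eventually.of_forall fun ζ hζ z hz => ?_)
    have hne : ζ - z ≠ 0 := norm_pos_iff.mp (hd2.trans_le (hfar ζ hζ z hz))
    exact (((hasDerivAt_id z).const_sub ζ).inv hne).congr_deriv (by simp)

/-- Dominated convergence: `z / (ζ - z)` tends to `-1` and is bounded by `2` once `‖z‖ ≥ 2 * R`. -/
theorem tendsto_mul_cauchyTransform {L : Set ℂ} (hL : IsCompact L) :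
    Tendsto (fun z => z * cauchyTransform L z) (cocompact ℂ) (𝓝 (-(volume.real L : ℂ))) := by
  have : IsFiniteMeasure (volume.restrict L) := ⟨by simpa using hL.measure_lt_top⟩
  have hcg : (cocompact ℂ).IsCountablyGenerated := by
    rw [← Metric.cobounded_eq_cocompact, ← comap_norm_atTop]; infer_instance
  have hval : (-(volume.real L : ℂ)) = ∫ _ in L, (-1 : ℂ) := by simp [Measure.real]
  have hfun : (fun z => z * cauchyTransform L z) = fun z => ∫ ζ in L, z * (ζ - z)⁻¹ := by
    funext z
    rw [cauchyTransform, integral_const_mul]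
  rw [hval, hfun]
  obtain ⟨R, hR0, hR⟩ := hL.isBounded.exists_pos_norm_le
  have hlarge : ∀ r : ℝ, ∀ᶠ z in cocompact ℂ, r ≤ ‖z‖ := fun r => by
    rw [← Metric.cobounded_eq_cocompact]
    exact tendsto_norm_cobounded_atTop.eventually_ge_atTop r
  have hnorm : ∀ ζ ∈ L, ∀ z : ℂ, 2 * R ≤ ‖z‖ → ‖z‖ / 2 ≤ ‖ζ - z‖ := by
    intro ζ hζ z hz
    have h1 := hR ζ hζ
    have h2 := norm_sub_norm_le z ζ
    rw [norm_sub_rev] at h2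
    linarith
  refine tendsto_integral_filter_of_dominated_convergence (fun _ => 2)
    (Eventually.of_forall fun z => ((integrableOn_cauchyKernel hL z).const_mul z).aestronglyMeasurable)
    ?_ (integrable_const _) ?_
  · filter_upwards [hlarge (2 * R)] with z hz
    refine (ae_restrict_iff' hL.measurableSet).mpr (Eventually.of_forall fun ζ hζ => ?_)
    have h1 := hnorm ζ hζ z hz
    have hz0 : 0 < ‖z‖ := by linarith
    rw [norm_mul, norm_inv, ← div_eq_mul_inv, div_le_iff₀ (by linarith)]
    linarith
  · refine (ae_restrict_iff' hL.measurableSet).mpr (Eventually.of_forall fun ζ hζ => ?_)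
    have hinv : Tendsto (fun z : ℂ => z⁻¹) (cocompact ℂ) (𝓝 0) := by
      rw [← Metric.cobounded_eq_cocompact]; exact tendsto_inv₀_cobounded
    have h1 : Tendsto (fun z : ℂ => (ζ * z⁻¹ - 1)⁻¹) (cocompact ℂ) (𝓝 (-1)) := by
      have := ((hinv.const_mul ζ).sub_const 1).inv₀ (by simp)
      simpa using this
    refine h1.congr' ?_
    filter_upwards [hlarge (2 * R)] with z hz
    have hz0 : z ≠ 0 := norm_pos_iff.mp (by linarith)
    have h3 : ζ * z⁻¹ - 1 = (ζ - z) * z⁻¹ := by rw [sub_mul, mul_inv_cancel₀ hz0]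
    rw [h3, mul_inv, inv_inv, mul_comm]

/-- A compact space with an injection into the plane whose image contains enough area has a closed
separating algebra without non-trivial idempotents. -/
theorem not_hasNTIP_of_injective {X : Type*} [TopologicalSpace X] [CompactSpace X]
    {φ : X → ℂ} (hφ : Continuous φ) (hinj : Function.Injective φ)
    (hvol : volume (range φ) ≠ 0) : ¬ HasNTIP X := by
  intro hX
  have hL : IsCompact (range φ) := isCompact_range hφ
  have hne : (range φ).Nonempty := by
    rw [nonempty_iff_ne_empty]
    intro h
    simp [h] at hvol
  have hm : (-(volume.real (range φ) : ℂ)) ≠ 0 := by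
    rw [neg_ne_zero, Complex.ofReal_ne_zero]
    exact (ENNReal.toReal_pos hvol hL.measure_lt_top.ne).ne'
  obtain ⟨f, hf, hidem, hf0, hf1⟩ :=
    hX ((holomorphicOffSubalgebra (range φ)).map (sphereRestrict ⟨φ, hφ⟩)) (fun x y hxy => by
      obtain ⟨F, hF, hFxy⟩ := exists_mem_holomorphicOffSubalgebra_ne hL
        (continuous_cauchyTransform hL) (differentiableOn_cauchyTransform hL) hm
        (tendsto_mul_cauchyTransform hL) (hinj.ne hxy)
      exact ⟨_, ⟨_, ⟨F, hF, rfl⟩, rfl⟩, hFxy⟩)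
      (isClosed_map_sphereRestrict ⟨φ, hφ⟩ hL.isClosed hne subset_rfl)
  rcases eq_zero_or_eq_one_of_mem_map_sphereRestrict ⟨φ, hφ⟩ hL.isClosed hne subset_rfl hf hidem
    with h | h
  · exact hf0 h
  · exact hf1 h

/-! ### Spreading ranges by distribution functions -/

/-- The measure of `{t | k y t < 0}` depends continuously on `y` if `k` is continuous in `y` and
the zero sets of the functions `k y` are null. -/
theorem continuous_measureReal_setOf_lt_zero {Y T : Type*} [TopologicalSpace Y]
    [FirstCountableTopology Y] [MeasurableSpace T] {m : Measure T} [IsFiniteMeasure m]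
    {k : Y → T → ℝ} (hk : ∀ t, Continuous fun y => k y t) (hmeas : ∀ y, Measurable (k y))
    (h0 : ∀ y, m {t | k y t = 0} = 0) : Continuous fun y => m.real {t | k y t < 0} := by
  have hms : ∀ y, MeasurableSet {t | k y t < 0} := fun y =>
    measurableSet_lt (hmeas y) measurable_const
  have hint : ∀ y, m.real {t | k y t < 0} = ∫ t, {t | k y t < 0}.indicator (1 : T → ℝ) t ∂m :=
    fun y => (integral_indicator_one (hms y)).symm
  simp_rw [hint]
  refine continuous_iff_continuousAt.mpr fun y => ?_
  refine continuousAt_of_dominated (bound := fun _ => 1)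
    (Eventually.of_forall fun z =>
      (measurable_one.indicator (hms z)).aestronglyMeasurable)
    (Eventually.of_forall fun z => Eventually.of_forall fun t => ?_) (integrable_const _) ?_
  · by_cases h : t ∈ {t | k z t < 0} <;> simp [h]
  · have hae : ∀ᵐ t ∂m, k y t ≠ 0 := by rw [ae_iff]; simpa using h0 y
    -- Where `k y t ≠ 0` the sign persists for nearby parameters, so the indicator is locally
    -- constant there.
    filter_upwards [hae] with t ht
    rcases lt_or_gt_of_ne ht with h | h
    · refine (continuousAt_const (y := (1 : ℝ))).congr ?_
      filter_upwards [(hk t).continuousAt.eventually_lt_const h] with z hz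
      exact (indicator_of_mem (show t ∈ {t | k z t < 0} from hz) (1 : T → ℝ)).symm
    · refine (continuousAt_const (y := (0 : ℝ))).congr ?_
      filter_upwards [(hk t).continuousAt.eventually_const_lt h] with z hz
      exact (indicator_of_notMem (show t ∉ {t | k z t < 0} from not_lt.mpr (le_of_lt hz))
        (1 : T → ℝ)).symm

/-- Adding its own distribution function to a continuous injective real function spreads the range
of the latter over a set of length at least one. -/
theorem one_le_volume_range_add_cdf {T : Type*} [TopologicalSpace T] [CompactSpace T]
    [MeasurableSpace T] [BorelSpace T] (m : Measure T) [IsProbabilityMeasure m] [NullSingletonClass m]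
    {h : T → ℝ} (hc : Continuous h) (hinj : Function.Injective h) :
    1 ≤ volume (range fun t => h t + m.real {t' | h t' < h t}) := by
  set c : T → ℝ := fun t => m.real {t' | h t' < h t} with hcdef
  set G : T → ℝ := fun t => h t + c t with hG
  have hmono : ∀ t t', h t ≤ h t' → c t ≤ c t' := fun t t' htt' =>
    measureReal_mono fun u hu => lt_of_lt_of_le hu htt'
  -- Since `h` and `c` increase together, `c` is a 1-Lipschitz function of `G`; the length of the
  -- range of `c` thus bounds that of `G` from below.
  have hdist : ∀ t t', dist (c t) (c t') ≤ dist (G t) (G t') := by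
    have key : ∀ t t', h t ≤ h t' → dist (c t) (c t') ≤ dist (G t) (G t') := by
      intro t t' htt'
      have h1 := hmono t t' htt'
      rw [dist_comm, dist_comm (G t), Real.dist_eq, Real.dist_eq, abs_of_nonneg (by linarith),
        abs_of_nonneg (by simp only [hG]; linarith)]
      simp only [hG]; linarith
    intro t t'
    rcases le_total (h t) (h t') with h1 | h1
    · exact key t t' h1
    · rw [dist_comm, dist_comm (G t)]; exact key t' t h1
  have hsurj : Ioo 0 1 ⊆ range c := by
    rintro p ⟨hp0, hp1⟩
    have hcont : Continuous fun y : ℝ => m.real {t | h t - y < 0} :=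
      continuous_measureReal_setOf_lt_zero (fun t => by fun_prop)
        (fun y => (hc.measurable.sub_const y)) fun y =>
        Set.Subsingleton.measure_zero (fun t ht t' ht' => hinj
          ((sub_eq_zero.mp ht).trans (sub_eq_zero.mp ht').symm)) m
    obtain ⟨R, hR⟩ := (isCompact_range hc).isBounded.exists_norm_le
    have hRt : ∀ t, -R ≤ h t ∧ h t ≤ R := fun t => abs_le.mp (hR _ ⟨t, rfl⟩)
    have hlow : m.real {t | h t - -R < 0} = 0 := by
      have : {t | h t - -R < 0} = ∅ := by
        ext t
        have := hRt t
        simp only [mem_ofPred_eq, mem_empty_iff_false, iff_false, not_lt]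
        linarith
      rw [this]; simp
    have hhigh : m.real {t | h t - (R + 1) < 0} = 1 := by
      have : {t | h t - (R + 1) < 0} = univ := by
        ext t
        have := hRt t
        simp only [mem_ofPred_eq, mem_univ, iff_true]
        linarith
      rw [this]; simp
    obtain ⟨y, hy⟩ := mem_range_of_exists_le_of_exists_ge hcont
      ⟨-R, hlow.trans_le hp0.le⟩ ⟨R + 1, hp1.le.trans hhigh.ge⟩
    simp only [sub_neg] at hy
    have hne : {t | h t ≤ y}.Nonempty := by
      by_contra hempty
      rw [not_nonempty_iff_eq_empty] at hempty
      have : {t | h t < y} = ∅ := subset_empty_iff.mp (hempty ▸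
        fun t (ht : h t < y) => show h t ≤ y from ht.le)
      rw [this] at hy
      simp at hy
      linarith
    -- The level `y` need not be a value of `h`. Replacing it by the largest value `h t₀ ≤ y`
    -- changes the sublevel set by at most the null point `t₀`.
    obtain ⟨t₀, ht₀, hmax⟩ := ((isClosed_le hc continuous_const).isCompact).exists_isMaxOn hne
      hc.continuousOn
    replace ht₀ : h t₀ ≤ y := ht₀
    refine ⟨t₀, ?_⟩
    have hle : {t | h t < h t₀} ⊆ {t | h t < y} := fun t (ht : h t < h t₀) => ht.trans_le ht₀
    have hnull : m ({t | h t < y} \ {t | h t < h t₀}) = 0 := by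
      refine Set.Subsingleton.measure_zero (Set.Subsingleton.anti subsingleton_singleton
        (t := {t₀}) fun t ht => ?_) m
      have h1 : h t < y := ht.1
      exact hinj (le_antisymm (hmax h1.le) (not_lt.mp ht.2))
    rw [← hy]
    exact congrArg ENNReal.toReal (measure_eq_measure_of_null_sdiff hle hnull)
  have hGinj : ∀ t t', G t = G t' → c t = c t' := fun t t' htt' => by
    have := hdist t t'
    rw [htt', dist_self] at this
    exact dist_le_zero.mp this
  rcases isEmpty_or_nonempty T with hT | hT
  · obtain ⟨t, -⟩ := hsurj (⟨by norm_num, by norm_num⟩ : (1 / 2 : ℝ) ∈ Ioo 0 1)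
    exact hT.elim t
  let ψ : ℝ → ℝ := fun y => c (Function.invFun G y)
  have hψ : ∀ t, ψ (G t) = c t := fun t =>
    hGinj _ _ (Function.invFun_eq ⟨t, rfl⟩)
  have hlip : LipschitzOnWith 1 ψ (range G) := by
    refine LipschitzOnWith.of_dist_le_mul ?_
    rintro _ ⟨t, rfl⟩ _ ⟨t', rfl⟩
    rw [hψ, hψ, NNReal.coe_one, one_mul]
    exact hdist t t'
  have himg : ψ '' range G = range c := by
    rw [← range_comp]
    exact congrArg range (funext hψ)
  have hH := hlip.hausdorffMeasure_image_le (d := 1) zero_le_one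
  rw [himg, hausdorffMeasure_real] at hH
  simp only [ENNReal.coe_one, ENNReal.one_rpow, one_mul] at hH
  calc (1 : ENNReal) = volume (Ioo (0 : ℝ) 1) := by simp
    _ ≤ volume (range c) := measure_mono hsurj
    _ ≤ _ := hH

/-- The Cantor space carries an atomless probability measure. -/
theorem exists_isProbabilityMeasure_nullSingletonClass_cantor :
    ∃ m : Measure (ℕ → Bool), IsProbabilityMeasure m ∧ NullSingletonClass m := by
  let E : ℝ ≃ᵐ (ℕ → Bool) := PolishSpace.measurableEquivNatBoolOfNotCountable
    (fun h => Cardinal.not_countable_real (countable_univ_iff.mpr h))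
  have hp : IsProbabilityMeasure (volume.restrict (Icc (0 : ℝ) 1)) := ⟨by simp⟩
  refine ⟨(volume.restrict (Icc (0 : ℝ) 1)).map E,
    Measure.isProbabilityMeasure_map E.measurable.aemeasurable, ⟨fun x => ?_⟩⟩
  rw [E.map_apply]
  exact (subsingleton_singleton.preimage E.injective).measure_zero _

/-! ### Embedding in the plane with positive area -/

/-- A second countable Stone space embeds continuously in the real line. -/
theorem exists_continuous_injective_real (X : Type*) [TopologicalSpace X] [CompactSpace X]
    [T2Space X] [TotallyDisconnectedSpace X] [SecondCountableTopology X] :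
    ∃ j : X → ℝ, Continuous j ∧ Function.Injective j := by
  have : Countable (TopologicalSpace.Clopens X) :=
    TopologicalSpace.Clopens.countable_iff_secondCountable.mpr inferInstance
  obtain ⟨U, hU⟩ := exists_surjective_nat (TopologicalSpace.Clopens X)
  let b : X → ℕ → Bool := fun x n => (U n : Set X).boolIndicator x
  have hb : Continuous b := continuous_pi fun n =>
    (continuous_boolIndicator_iff_isClopen _).mpr (U n).isClopen
  have hbinj : Function.Injective b := by
    intro x y hxy
    by_contra hne
    obtain ⟨V, hV, hxV, hyV⟩ := exists_isClopen_of_totally_separated hne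
    obtain ⟨n, hn⟩ := hU ⟨V, hV⟩
    have h1 : V.boolIndicator x = V.boolIndicator y := by
      have := congrFun hxy n
      simp only [b, hn] at this; exact this
    rw [(mem_iff_boolIndicator V x).mp hxV] at h1
    exact hyV ((mem_iff_boolIndicator V y).mpr h1.symm)
  exact ⟨fun x => (cantorSetHomeomorphNatToBool.symm (b x) : ℝ),
    continuous_subtype_val.comp (cantorSetHomeomorphNatToBool.symm.continuous.comp hb),
    Subtype.val_injective.comp (cantorSetHomeomorphNatToBool.symm.injective.comp hbinj)⟩

/-- The first coordinate of a copy of `S × T` in a Stone space extends to the whole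
space when `S` is the Cantor space. -/
theorem exists_continuous_extension_cantor {X T : Type*} [TopologicalSpace X] [CompactSpace X]
    [T2Space X] [TotallyDisconnectedSpace X] [TopologicalSpace T] [CompactSpace T]
    {e : (ℕ → Bool) × T → X} (he : Continuous e) (hinj : Function.Injective e) :
    ∃ r : X → ℕ → Bool, Continuous r ∧ ∀ p, r (e p) = p.1 := by
  have hcl : ∀ n b, IsClosed (e '' {p | p.1 n = b}) := fun n b =>
    ((isClosed_eq ((continuous_apply n).comp continuous_fst)
      continuous_const).isCompact.image he).isClosed
  -- A clopen set separates the disjoint closed images of the two values of the `n`-th bit; it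
  -- extends that bit to `X`.
  have hex : ∀ n, ∃ C : Set X, IsClopen C ∧ e '' {p | p.1 n = true} ⊆ C ∧
      C ⊆ (e '' {p | p.1 n = false})ᶜ := fun n => by
    refine exists_clopen_of_closed_subset_open (hcl n true) (hcl n false).isOpen_compl ?_
    rintro _ ⟨p, hp, rfl⟩ ⟨q, hq, hqp⟩
    rw [hinj hqp] at hq
    exact Bool.noConfusion (hp.symm.trans hq)
  choose C hC h1 h2 using hex
  refine ⟨fun x n => (C n).boolIndicator x, continuous_pi fun n =>
    (continuous_boolIndicator_iff_isClopen _).mpr (hC n), fun p => funext fun n => ?_⟩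
  cases hp : p.1 n with
  | true => exact (mem_iff_boolIndicator _ _).mp (h1 n ⟨p, hp, rfl⟩)
  | false => exact (notMem_iff_boolIndicator _ _).mp fun hmem => h2 n hmem ⟨p, hp, rfl⟩

/-- A nonempty perfect set in a second countable compact Hausdorff space contains a copy of the
square of the Cantor space. -/
theorem Perfect.exists_cantor_prod_injection {X : Type*} [TopologicalSpace X] [CompactSpace X]
    [T2Space X] [SecondCountableTopology X] {C : Set X} (hC : Perfect C) (hne : C.Nonempty) :
    ∃ e : (ℕ → Bool) × (ℕ → Bool) → X, Continuous e ∧ Function.Injective e := by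
  let := TopologicalSpace.metrizableSpaceMetric X
  obtain ⟨f, -, hf, hfinj⟩ := hC.exists_nat_bool_injection hne
  let q : (ℕ → Bool) × (ℕ → Bool) → (ℕ → Bool) := fun p n =>
    Sum.elim p.1 p.2 (Equiv.natSumNatEquivNat.symm n)
  have hq : Continuous q := by
    refine continuous_pi fun n => ?_
    rcases hn : Equiv.natSumNatEquivNat.symm n with i | i <;> simp only [q, hn, Sum.elim_inl,
      Sum.elim_inr] <;> fun_prop
  have hqinj : Function.Injective q := by
    intro p p' h
    have h' : ∀ i, Sum.elim p.1 p.2 i = Sum.elim p'.1 p'.2 i := fun i => by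
      have := congrFun h (Equiv.natSumNatEquivNat i)
      simpa only [q, Equiv.symm_apply_apply] using this
    exact Prod.ext (funext fun i => h' (Sum.inl i)) (funext fun i => h' (Sum.inr i))
  exact ⟨f ∘ q, hf.comp hq, hfinj.comp hqinj⟩

/-- A second countable Stone space with a nonempty perfect subset embeds in the plane with
positive area. -/
theorem exists_continuous_injective_complex {X : Type*} [TopologicalSpace X] [CompactSpace X]
    [T2Space X] [TotallyDisconnectedSpace X] [SecondCountableTopology X] {C : Set X}
    (hC : Perfect C) (hne : C.Nonempty) :
    ∃ φ : X → ℂ, Continuous φ ∧ Function.Injective φ ∧ volume (range φ) ≠ 0 := by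
  obtain ⟨e, he, heinj⟩ := hC.exists_cantor_prod_injection hne
  obtain ⟨j, hj, hjinj⟩ := exists_continuous_injective_real X
  obtain ⟨r, hr, hre⟩ := exists_continuous_extension_cantor he heinj
  obtain ⟨m, hm, hm0⟩ := exists_isProbabilityMeasure_nullSingletonClass_cantor
  have hslice : ∀ s, Function.Injective fun t => j (e (s, t)) := fun s =>
    hjinj.comp (heinj.comp (Prod.mk_right_injective s))
  let h₀ : (ℕ → Bool) → ℝ := fun s => j (e (s, fun _ => true))
  have hh₀ : Continuous h₀ := by fun_prop
  have hh₀inj : Function.Injective h₀ := hjinj.comp (heinj.comp (Prod.mk_left_injective _))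
  let F : (ℕ → Bool) → ℝ := fun s => h₀ s + m.real {s' | h₀ s' < h₀ s}
  -- The distribution function is that of `j` on the slice over `r x`. At `e (s, t)` this is exactly
  -- the spread of `j` on the slice over `s`; on every fibre of `r`, `v` is strictly increasing in
  -- `j`.
  let v : X → ℝ := fun x => j x + m.real {t | j (e (r x, t)) < j x}
  have hF : Continuous F := by
    have := continuous_measureReal_setOf_lt_zero (m := m) (k := fun s s' => h₀ s' - h₀ s)
      (fun t => by fun_prop) (fun s => (hh₀.measurable.sub_const _)) fun s =>
        Set.Subsingleton.measure_zero (fun t ht t' ht' => hh₀inj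
          ((sub_eq_zero.mp ht).trans (sub_eq_zero.mp ht').symm)) m
    simp only [sub_neg] at this
    exact hh₀.add this
  have hv : Continuous v := by
    have := continuous_measureReal_setOf_lt_zero (m := m) (k := fun x t => j (e (r x, t)) - j x)
      (fun t => by fun_prop)
      (fun x => (Continuous.measurable (by fun_prop : Continuous fun t => j (e (r x, t)) - j x)))
      fun x => Set.Subsingleton.measure_zero (fun t ht t' ht' => hslice (r x)
          ((sub_eq_zero.mp ht).trans (sub_eq_zero.mp ht').symm)) m
    simp only [sub_neg] at this
    exact hj.add this
  have hFinj : Function.Injective F := by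
    intro s s' hss'
    by_contra hne'
    have key : ∀ u u', h₀ u < h₀ u' → F u < F u' := fun u u' huu' =>
      add_lt_add_of_lt_of_le huu' (measureReal_mono fun w hw => lt_trans hw huu')
    rcases lt_or_gt_of_ne (hh₀inj.ne hne') with h1 | h1
    · exact (key _ _ h1).ne hss'
    · exact (key _ _ h1).ne' hss'
  let P : X → ℝ × ℝ := fun x => (F (r x), v x)
  have hP : Continuous P := by fun_prop
  have hPinj : Function.Injective P := by
    intro x x' hxx'
    have h1 : r x = r x' := hFinj (congrArg Prod.fst hxx')
    have h2 : v x = v x' := congrArg Prod.snd hxx'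
    by_contra hne'
    have key : ∀ u u', r u = r u' → j u < j u' → v u < v u' := fun u u' hr' huu' => by
      simp only [v, hr']
      exact add_lt_add_of_lt_of_le huu' (measureReal_mono fun w hw => lt_trans hw huu')
    rcases lt_or_gt_of_ne (hjinj.ne hne') with h3 | h3
    · exact (key _ _ h1 h3).ne h2
    · exact (key _ _ h1.symm h3).ne' h2
  have hvolP : 1 ≤ volume (range P) := by
    have hmeas : MeasurableSet (range P) := (isCompact_range hP).measurableSet
    rw [Measure.volume_eq_prod, Measure.prod_apply hmeas]
    -- Fubini: the base has length at least `1`, and so has the slice over each `F s`.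
    calc (1 : ENNReal) ≤ volume (range F) := one_le_volume_range_add_cdf m hh₀ hh₀inj
      _ = ∫⁻ _ in range F, 1 := by simp
      _ ≤ ∫⁻ a in range F, volume (Prod.mk a ⁻¹' range P) := by
          refine setLIntegral_mono' (isCompact_range hF).measurableSet ?_
          rintro _ ⟨s, rfl⟩
          refine (one_le_volume_range_add_cdf m (h := fun t => j (e (s, t))) (by fun_prop)
            (hslice s)).trans (measure_mono ?_)
          rintro _ ⟨t, rfl⟩
          exact ⟨e (s, t), by simp [P, v, hre]⟩
      _ ≤ _ := setLIntegral_le_lintegral _ _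
  refine ⟨fun x => Complex.measurableEquivRealProd.symm (P x),
    Complex.equivRealProdCLM.symm.continuous.comp hP,
    Complex.measurableEquivRealProd.symm.injective.comp hPinj, ?_⟩
  have hpre : Complex.measurableEquivRealProd.symm ⁻¹'
      (range fun x => Complex.measurableEquivRealProd.symm (P x)) = range P := by
    rw [range_comp' Complex.measurableEquivRealProd.symm P,
      preimage_image_eq _ Complex.measurableEquivRealProd.symm.injective]
  rw [← Complex.volume_preserving_equiv_real_prod.symm.measure_preimage_equiv, hpre]
  exact (zero_lt_one.trans_le hvolP).ne'

theorem corollary6p5 {X : Type*} [TopologicalSpace X] [CompactSpace X] [T2Space X]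
    [TotallyDisconnectedSpace X]
    (hne : (CantorBendixson.perfectKernel (Set.univ : Set X)).Nonempty)
    (hsc : SecondCountableTopology (CantorBendixson.perfectKernel (Set.univ : Set X))) :
    HasNTIP X ↔ ¬ SecondCountableTopology X := by
  refine ⟨fun hX h2 => ?_, HasNTIP.of_not_secondCountableTopology hne⟩
  obtain ⟨φ, hφ, hinj, hvol⟩ :=
    exists_continuous_injective_complex (CantorBendixson.perfect_perfectKernel isClosed_univ) hne
  exact not_hasNTIP_of_injective hφ hinj hvol hX
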